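/- Let $K$ be a number field with ring of integers $\mathcal{O}_K$, let $p$ be an odd prime, and let $\mathfrak{p}\subset\mathcal{O}_K$ be a prime above $p$ with ramification index $e$ and residue class degree $f$ over $p$. Let $K_{\mathfrak{p}}$ be the completion of $K$ at $\mathfrak{p}$ and $v_{\mathfrak{p}}$ the $\mathfrak{p}$-adic valuation, normalized to take the value $1$ on uniformizers. Suppose that $p\nmid e$ and that, inside an algebraic closure of $K_{\mathfrak{p}}$, $K_{\mathfrak{p}}\cap\mathbb{Q}_p(\zeta_{p^\infty})=\mathbb{Q}_p$. Let $m\ge 0$ and let $x^{p^m}-a\in\mathcal{O}_K[x]$ be irreducible. Write $a=a_0\pi^{hp^k}$, where $\pi\in\mathcal{O}_K$ with $v_{\mathfrak{p}}(\pi)=1$, $a_0\in K$ with $v_{\mathfrak{p}}(a_0)=0$, and $h\geq 1$, $k\ge 0$ are integers with $p\nmid h$. Let $\mu$ be the integer with $1\le\mu\le f$ and $\mu\equiv m \bmod f$, and put \[ w_0=v_{\mathfrak{p}}\big(a_0^{p^{f-\mu+m}}-a_0\big),\qquad l_0=\left\lceil \frac{w_0}{e}-\frac{p}{p-1}\right\rceil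 , \] with $l_0=\infty$ if $w_0=\infty$. If $l_0\le 0$, suppose that $p\nmid w_0$; and if $l_0<m$, suppose that $p\nmid (e\,l_0-w_0)$. Let $c=\max\big(0,\min(m,l_0,k)\big)$. Then $a$ has a $p^c$-th root in $K_{\mathfrak{p}}$, and for every such root $\sqrt[p^c]{a}\in K_{\mathfrak{p}}$, \[ x^{p^m}-a=\Big(x^{p^{m-c}}-\sqrt[p^c]{a}\Big)\prod_{i=1}^{c}\Phi_{p^i}\Big(x^{p^{m-c}},\sqrt[p^c]{a}\Big) \] is a factorization into irreducibles in $K_{\mathfrak{p}}[x]$, where the product is $1$ if $c=0$. Here \[ \Phi_{p^i}(x,b)=\prod_{\substack{1\le j<p^i\\ \gcd(j,p)=1}}\big(x-\zeta_{p^i}^{\,j}\,b\big) \] is the twisted cyclotomic polynomial, with $\zeta_{p^i}$ a primitive $p^i$-th root of unity; it has coefficients in $K_{\mathfrak{p}}$ for $b=\sqrt[p^c]{a}$. -/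

import Mathlib

open Polynomial NumberField IsDedekindDomain

noncomputable section

/-- The additive valuation `v_𝔭 : K → ℤ ∪ {∞}`, normalized so that a uniformizer has value `1`. -/
def primeOrd {K : Type*} [Field K] [NumberField K] (v : HeightOneSpectrum (𝓞 K)) (x : K) :
    WithTop ℤ :=
  open Classical in
  if x = 0 then ⊤ else ((-(WithZero.log (v.valuation K x)) : ℤ) : WithTop ℤ)

/-- The integer `⌈w / e - p / (p - 1)⌉`. -/
def wieferichLevel (p e : ℕ) (w : ℤ) : ℤ :=
  ⌈(w : ℚ) / (e : ℚ) - (p : ℚ) / ((p : ℚ) - 1)⌉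

/-- The extension of `wieferichLevel` with value `∞` at `w = ∞`. -/
def wieferichLevelTop (p e : ℕ) (w : WithTop ℤ) : WithTop ℤ :=
  w.map (wieferichLevel p e)

/-- The field `ℚ_p` inside `K_𝔭` (with `𝔭` above `p`): the closure of the prime field `ℚ`. -/
def padicSubfield {K : Type*} [Field K] [NumberField K] (v : HeightOneSpectrum (𝓞 K)) :
    Subfield (v.adicCompletion K) :=
  (⊥ : Subfield (v.adicCompletion K)).topologicalClosure

/-- `ℚ_p` inside the algebraic closure of `K_𝔭`. -/
def padicSubfieldInClosure {K : Type*} [Field K] [NumberField K] (v : HeightOneSpectrum (𝓞 K)) :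
    Subfield (AlgebraicClosure (v.adicCompletion K)) :=
  (padicSubfield v).map (algebraMap (v.adicCompletion K) (AlgebraicClosure (v.adicCompletion K)))

/-- The field `ℚ_p(ζ_{p^∞})` inside the algebraic closure of `K_𝔭`, obtained from `ℚ_p` by
adjoining all roots of unity of `p`-power order. -/
def padicCyclotomicSubfield {K : Type*} [Field K] [NumberField K] (p : ℕ)
    (v : HeightOneSpectrum (𝓞 K)) : Subfield (AlgebraicClosure (v.adicCompletion K)) :=
  padicSubfieldInClosure v ⊔
    Subfield.closure {z : AlgebraicClosure (v.adicCompletion K) | ∃ n : ℕ, z ^ p ^ n = 1}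

/-- The twisted cyclotomic polynomial `Φ_{p^j}(x, b) = ∏ (x - ζ^k b)`, the product over
`1 ≤ k < p^j` with `gcd(k, p) = 1`, where `ζ` is a primitive `p^j`-th root of unity. -/
def twistedCyclotomic {L : Type*} [Field L] (p j : ℕ) (ζ b : L) : L[X] :=
  ∏ k ∈ (Finset.Ico 1 (p ^ j)).filter (fun k => Nat.gcd k p = 1), (X - C (ζ ^ k * b))

end

/-!
Let `F = K_𝔭` and `α ^ p ^ c = a`. Eisenstein's criterion makes the `p ^ i`-th cyclotomic
polynomials irreducible over `ℚ_p`; they stay irreducible over `F`, because the coefficients of a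
monic factor lie in `F ∩ ℚ_p(ζ_{p^∞}) = ℚ_p`. Hence `Φ_{p^i}(x, α)`, whose roots are the `α ζ` with
`ζ` a primitive `p ^ i`-th root of unity, is irreducible, and it remains so after substituting
`x ^ p ^ (m - c)`, because `α ζ` is not a `p`-th power in `F(ζ)`. The first factor is irreducible as
soon as `α` is not a `p`-th power in `F`, and since `F` contains no `p`-th root of unity other than
`1`, this says that `a` is not a `p ^ (c + 1)`-th power.

If `c = k < m`, the valuation of `a` shows that. If `c < k`, it is a question about the unit `a₀`,
or equivalently about `a₀ ^ (p ^ N - 1)`, whose distance from `1` is measured by `w₀`. Near `1` the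
`p`-th power map raises the valuation of `x - 1` by exactly `e`, so `p ^ c`-th roots exist up to the
level `l₀`; farther away it multiplies the valuation by `p`, and `p ∤ w₀ - e c` excludes one more
root.
-/

theorem scaleRoots_prod {R ι : Type*} [CommRing R] [IsDomain R] (s : Finset ι) (g : ι → R[X])
    (r : R) : (∏ i ∈ s, g i).scaleRoots r = ∏ i ∈ s, (g i).scaleRoots r := by
  induction s using Finset.cons_induction with
  | empty => simp
  | cons i s hi ih => rw [Finset.prod_cons, Finset.prod_cons, mul_scaleRoots_of_noZeroDivisors, ih]

theorem X_pow_sub_C_scaleRoots {R : Type*} [CommRing R] [Nontrivial R] {n : ℕ} (hn : n ≠ 0)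
    (a r : R) : (X ^ n - C a).scaleRoots r = X ^ n - C (a * r ^ n) := by
  ext i
  rw [coeff_scaleRoots, natDegree_X_pow_sub_C, coeff_sub, coeff_sub, coeff_X_pow, coeff_C, coeff_C]
  split_ifs <;> simp_all

theorem irreducible_scaleRoots {F : Type*} [Field F] {g : F[X]} (hg : Irreducible g) {r : F}
    (hr : r ≠ 0) : Irreducible (g.scaleRoots r) := by
  have isUnit_of_scaleRoots (q : F[X]) (s : F) (hq : IsUnit (q.scaleRoots s)) : IsUnit q := by
    rw [isUnit_iff_degree_eq_zero] at hq ⊢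
    rwa [degree_scaleRoots] at hq
  refine ⟨fun h ↦ hg.not_isUnit (isUnit_of_scaleRoots _ _ h), fun q₁ q₂ hq ↦ ?_⟩
  have hg_eq : g = q₁.scaleRoots r⁻¹ * q₂.scaleRoots r⁻¹ := by
    rw [← mul_scaleRoots_of_noZeroDivisors, ← hq, ← scaleRoots_mul, mul_inv_cancel₀ hr,
      scaleRoots_one]
  exact (hg.isUnit_or_isUnit hg_eq).imp (isUnit_of_scaleRoots _ _) (isUnit_of_scaleRoots _ _)

theorem X_pow_prime_pow_sub_one_eq_prod_cyclotomic (R : Type*) [CommRing R] {p : ℕ} (hp : p.Prime)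
    (c : ℕ) : (X ^ p ^ c - 1 : R[X]) = (X - 1) * ∏ i ∈ Finset.Icc 1 c, cyclotomic (p ^ i) R := by
  have := Fact.mk hp
  induction c with
  | zero => simp
  | succ c ih =>
    rw [Finset.prod_Icc_succ_top (by omega), ← mul_assoc, ← ih, mul_comm,
      cyclotomic_prime_pow_mul_X_pow_sub_one]

theorem X_pow_prime_pow_sub_C_eq_prod_cyclotomic {R : Type*} [CommRing R] [IsDomain R] {p m c : ℕ}
    (hp : p.Prime) (hcm : c ≤ m) (b : R) :
    (X ^ p ^ m - C (b ^ p ^ c) : R[X]) = (X ^ p ^ (m - c) - C b) *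
      ∏ i ∈ Finset.Icc 1 c, ((cyclotomic (p ^ i) R).scaleRoots b).comp (X ^ p ^ (m - c)) := by
  have hlin : (X - 1 : R[X]).scaleRoots b = X - C b := by
    simpa using X_sub_C_scaleRoots (1 : R) b
  have hpow : (X ^ p ^ c - 1 : R[X]).scaleRoots b = X ^ p ^ c - C (b ^ p ^ c) := by
    simpa using X_pow_sub_C_scaleRoots (pow_pos hp.pos c).ne' (1 : R) b
  calc (X ^ p ^ m - C (b ^ p ^ c) : R[X])
      = ((X ^ p ^ c - 1 : R[X]).scaleRoots b).comp (X ^ p ^ (m - c)) := by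
        rw [hpow, sub_comp, pow_comp, X_comp, C_comp, ← pow_mul, ← pow_add, Nat.sub_add_cancel hcm]
    _ = _ := by
        rw [X_pow_prime_pow_sub_one_eq_prod_cyclotomic R hp, mul_scaleRoots_of_noZeroDivisors,
          scaleRoots_prod, hlin, mul_comp, prod_comp, sub_comp, X_comp, C_comp]

theorem twistedCyclotomic_eq_scaleRoots {F : Type*} [Field F] {p i : ℕ} (hp : p.Prime)
    (hi : i ≠ 0) {ζ : F} (hζ : IsPrimitiveRoot ζ (p ^ i)) (b : F) :
    twistedCyclotomic p i ζ b = (cyclotomic (p ^ i) F).scaleRoots b := by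
  have hpos : 0 < p ^ i := pow_pos hp.pos i
  have : NeZero (p ^ i) := ⟨hpos.ne'⟩
  simp only [cyclotomic_eq_prod_X_sub_primitiveRoots hζ, scaleRoots_prod, twistedCyclotomic,
    X_sub_C_scaleRoots]
  refine Finset.prod_bij (fun k _ ↦ ζ ^ k) (fun k hk ↦ ?_) (fun k hk l hl ↦ ?_) (fun ξ hξ ↦ ?_)
    fun _ _ ↦ rfl
  · rw [Finset.mem_filter] at hk
    exact (mem_primitiveRoots hpos).mpr (hζ.pow_of_coprime k (Nat.Coprime.pow_right i hk.2))
  · simp only [Finset.mem_filter, Finset.mem_Ico] at hk hl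
    exact hζ.pow_inj hk.1.2 hl.1.2
  · rw [mem_primitiveRoots hpos, hζ.isPrimitiveRoot_iff] at hξ
    obtain ⟨k, hk, hkp, rfl⟩ := hξ
    have hkp' : Nat.Coprime k p := hkp.coprime_dvd_right (dvd_pow_self p hi)
    have hk0 : k ≠ 0 := by
      rintro rfl
      exact hp.one_lt.ne' ((Nat.coprime_zero_left p).mp hkp')
    exact ⟨k, Finset.mem_filter.mpr
      ⟨Finset.mem_Ico.mpr ⟨Nat.one_le_iff_ne_zero.mpr hk0, hk⟩, hkp'⟩, rfl⟩

section Irreducibility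

theorem isPrimitiveRoot_prime_pow_succ {M : Type*} [CommMonoid M] {p i : ℕ} (hp : p.Prime)
    (hi : i ≠ 0) {θ : M} (hθ : IsPrimitiveRoot (θ ^ p) (p ^ i)) :
    IsPrimitiveRoot θ (p ^ (i + 1)) := by
  have := Fact.mk hp
  obtain ⟨j, rfl⟩ := Nat.exists_eq_succ_of_ne_zero hi
  refine IsPrimitiveRoot.iff_orderOf.mpr (orderOf_eq_prime_pow (fun h1 ↦ ?_) ?_)
  · rw [pow_succ', pow_mul] at h1
    exact (Nat.pow_dvd_pow_iff_le_right hp.one_lt).not.mpr j.lt_succ_self.not_ge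
      (hθ.dvd_of_pow_eq_one _ h1)
  · rw [pow_succ', pow_mul, hθ.pow_eq_one]

variable {F : Type*} [Field F] {p i : ℕ}

theorem pow_prime_pow_injective (hp : p.Prime) (hp2 : p ≠ 2) (hcyc : Irreducible (cyclotomic p F))
    (c : ℕ) : Function.Injective fun x : F ↦ x ^ p ^ c := by
  have := Fact.mk hp
  have eq_one_of_pow_eq_one (z : F) (hz : z ^ p = 1) : z = 1 := by
    by_contra hne
    have heval : (cyclotomic p F).eval z * (z - 1) = 0 := by
      simpa [hz] using congrArg (eval z) (cyclotomic_prime_mul_X_sub_one F p)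
    have hroot := (mul_eq_zero.mp heval).resolve_right (sub_ne_zero.mpr hne)
    have hdeg := degree_eq_one_of_irreducible_of_root hcyc hroot
    rw [degree_cyclotomic, Nat.totient_prime hp, Nat.cast_eq_one] at hdeg
    omega
  have hinj : Function.Injective fun x : F ↦ x ^ p := by
    intro x y (hxy : x ^ p = y ^ p)
    rcases eq_or_ne y 0 with rfl | hy
    · exact eq_zero_of_pow_eq_zero (hxy.trans (zero_pow hp.ne_zero))
    · refine (div_eq_one_iff_eq hy).mp (eq_one_of_pow_eq_one _ ?_)
      rw [div_pow, hxy, div_self (pow_ne_zero p hy)]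
  simpa only [pow_iterate] using hinj.iterate c

variable [CharZero F] {E : Type*} [Field E] [Algebra F E]

-- If `γ ^ p = b ζ` and `σ ζ = ζ ^ 2`, then `σ γ / γ` is a `p`-th root of `ζ`, which is too large a
-- root of unity for `F(ζ)`. The automorphism `σ` is where `p` has to be odd.
theorem pow_prime_ne_algebraMap_mul_of_isCyclotomicExtension (hp : p.Prime) (hp2 : p ≠ 2)
    (hcyc : ∀ i, Irreducible (cyclotomic (p ^ i) F)) (hi : i ≠ 0)
    [IsCyclotomicExtension {p ^ i} F E] {ζ : E} (hζ : IsPrimitiveRoot ζ (p ^ i)) {b : F}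
    (hb : b ≠ 0) (γ : E) : γ ^ p ≠ algebraMap F E b * ζ := by
  intro hγ
  have : NeZero (p ^ i) := ⟨(pow_pos hp.pos i).ne'⟩
  have : FiniteDimensional F E := IsCyclotomicExtension.finiteDimensional {p ^ i} F E
  have : IsGalois F E := IsCyclotomicExtension.isGalois {p ^ i} F E
  have hbζ : algebraMap F E b * ζ ≠ 0 := mul_ne_zero (by simpa) (hζ.ne_zero (NeZero.ne _))
  obtain ⟨σ, hσ⟩ : ∃ σ : E ≃ₐ[F] E, σ ζ = ζ ^ 2 := by
    have hζ2 : IsPrimitiveRoot (ζ ^ 2) (p ^ i) := hζ.pow_of_coprime 2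
      (Nat.Coprime.pow_right i ((Nat.coprime_primes Nat.prime_two hp).mpr hp2.symm))
    refine minpoly.exists_algEquiv_of_root' (Algebra.IsAlgebraic.isAlgebraic ζ) ?_
    rw [← hζ.minpoly_eq_cyclotomic_of_irreducible (hcyc i),
      hζ2.minpoly_eq_cyclotomic_of_irreducible (hcyc i), minpoly.aeval]
  have hθ : (σ γ / γ) ^ p = ζ := by
    rw [div_pow, ← map_pow, hγ, div_eq_iff hbζ, map_mul, σ.commutes, hσ]
    ring
  have hprim : IsPrimitiveRoot (σ γ / γ) (p ^ (i + 1)) :=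
    isPrimitiveRoot_prime_pow_succ hp hi (hθ ▸ hζ)
  have hle : p * (p ^ i).totient ≤ (p ^ i).totient := by
    have hdeg := hprim.lcm_totient_le_finrank hprim (K := F) (by simpa using hcyc (i + 1))
    rwa [Nat.lcm_self, IsCyclotomicExtension.finrank E (hcyc i), pow_succ',
      Nat.totient_mul_of_prime_of_dvd hp (dvd_pow_self p hi)] at hdeg
  exact (lt_mul_of_one_lt_left (Nat.totient_pos.mpr (pow_pos hp.pos i)) hp.one_lt).not_ge hle

open IntermediateField in
theorem pow_prime_ne_algebraMap_mul_of_mem_adjoin (hp : p.Prime) (hp2 : p ≠ 2)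
    (hcyc : ∀ i, Irreducible (cyclotomic (p ^ i) F)) (hi : i ≠ 0) {ζ : E}
    (hζ : IsPrimitiveRoot ζ (p ^ i)) {b : F} (hb : b ≠ 0) {γ : E} (hγ : γ ∈ F⟮ζ⟯) :
    γ ^ p ≠ algebraMap F E b * ζ := by
  have : NeZero (p ^ i) := ⟨(pow_pos hp.pos i).ne'⟩
  have : IsCyclotomicExtension {p ^ i} F F⟮ζ⟯ := by
    change IsCyclotomicExtension {p ^ i} F F⟮ζ⟯.toSubalgebra
    rw [adjoin_simple_toSubalgebra_of_isAlgebraic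
      (hζ.isIntegral (NeZero.pos _) |>.tower_top : IsIntegral F ζ).isAlgebraic]
    exact hζ.adjoin_isCyclotomicExtension F
  have hgen : IsPrimitiveRoot (AdjoinSimple.gen F ζ) (p ^ i) :=
    IsPrimitiveRoot.coe_submonoidClass_iff.mp hζ
  intro h
  exact pow_prime_ne_algebraMap_mul_of_isCyclotomicExtension hp hp2 hcyc hi hgen hb ⟨γ, hγ⟩
    (Subtype.ext h)

theorem isPrimitiveRoot_div_of_aeval_scaleRoots_cyclotomic {n : ℕ} (hn : n ≠ 0) {b : F}
    (hb : b ≠ 0) {x : E} (hx : aeval x ((cyclotomic n F).scaleRoots b) = 0) :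
    IsPrimitiveRoot (x / algebraMap F E b) n := by
  have : CharZero E := charZero_of_injective_algebraMap (algebraMap F E).injective
  have : NeZero (n : E) := ⟨Nat.cast_ne_zero.mpr hn⟩
  have hb' : algebraMap F E b ≠ 0 := by simpa
  rw [← mul_div_cancel₀ x hb', aeval_def, scaleRoots_eval₂_mul] at hx
  rw [← isRoot_cyclotomic_iff, IsRoot.def, ← map_cyclotomic n (algebraMap F E), eval_map]
  exact (mul_eq_zero.mp hx).resolve_left (pow_ne_zero _ hb')

open IntermediateField in
theorem irreducible_scaleRoots_cyclotomic_comp (hp : p.Prime) (hp2 : p ≠ 2)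
    (hcyc : ∀ i, Irreducible (cyclotomic (p ^ i) F)) (hi : i ≠ 0) {b : F} (hb : b ≠ 0) (n : ℕ) :
    Irreducible (((cyclotomic (p ^ i) F).scaleRoots b).comp (X ^ p ^ n)) := by
  refine irreducible_comp ((monic_scaleRoots_iff b).mpr (cyclotomic.monic _ _)) (monic_X_pow _)
    (irreducible_scaleRoots (hcyc i) hb) fun E _ _ x hx ↦ ?_
  have hζ : IsPrimitiveRoot (x / algebraMap F E b) (p ^ i) :=
    isPrimitiveRoot_div_of_aeval_scaleRoots_cyclotomic (pow_pos hp.pos i).ne' hb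
      (hx ▸ minpoly.aeval F x)
  have hbζ : algebraMap F E b * (x / algebraMap F E b) = x := mul_div_cancel₀ _ (by simpa)
  have hle : F⟮x⟯ ≤ F⟮x / algebraMap F E b⟯ := by
    rw [adjoin_simple_le_iff]
    have hmem := mul_mem (F⟮x / algebraMap F E b⟯.algebraMap_mem b)
      (mem_adjoin_simple_self F (x / algebraMap F E b))
    rwa [hbζ] at hmem
  rw [Polynomial.map_pow, map_X]
  refine X_pow_sub_C_irreducible_of_prime_pow hp hp2 n fun γ hγ ↦ ?_
  refine pow_prime_ne_algebraMap_mul_of_mem_adjoin hp hp2 hcyc hi hζ hb (hle γ.2) ?_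
  rw [hbζ]
  exact congrArg Subtype.val hγ

theorem exists_irreducible_twistedCyclotomic_factorization (Ω : Type*) [Field Ω] [Algebra F Ω]
    (hp : p.Prime) (hp2 : p ≠ 2) (hcyc : ∀ i, Irreducible (cyclotomic (p ^ i) F)) {m c : ℕ}
    (hcm : c ≤ m) {α : F} (hα0 : α ≠ 0) (hα : c < m → ∀ δ, δ ^ p ≠ α) :
    ∃ Φ : ℕ → F[X],
      (∀ i ∈ Finset.Icc 1 c, ∀ ζ : Ω, IsPrimitiveRoot ζ (p ^ i) →
        (Φ i).map (algebraMap F Ω) = twistedCyclotomic p i ζ (algebraMap F Ω α)) ∧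
      (X ^ p ^ m - C (α ^ p ^ c) : F[X]) =
        (X ^ p ^ (m - c) - C α) * ∏ i ∈ Finset.Icc 1 c, (Φ i).comp (X ^ p ^ (m - c)) ∧
      Irreducible (X ^ p ^ (m - c) - C α) ∧
      ∀ i ∈ Finset.Icc 1 c, Irreducible ((Φ i).comp (X ^ p ^ (m - c))) := by
  have ne_zero_of_mem {i : ℕ} (hi : i ∈ Finset.Icc 1 c) : i ≠ 0 :=
    Nat.one_le_iff_ne_zero.mp (Finset.mem_Icc.mp hi).1
  refine ⟨fun i ↦ (cyclotomic (p ^ i) F).scaleRoots α, fun i hi ζ hζ ↦ ?_,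
    X_pow_prime_pow_sub_C_eq_prod_cyclotomic hp hcm α, ?_, fun i hi ↦
      irreducible_scaleRoots_cyclotomic_comp hp hp2 hcyc (ne_zero_of_mem hi) hα0 _⟩
  · rw [twistedCyclotomic_eq_scaleRoots hp (ne_zero_of_mem hi) hζ, map_scaleRoots,
      map_cyclotomic]
    simp [(cyclotomic.monic (p ^ i) F).leadingCoeff]
  · rcases hcm.eq_or_lt with rfl | hlt
    · simpa using irreducible_X_sub_C α
    · exact X_pow_sub_C_irreducible_of_prime_pow hp hp2 _ (hα hlt)

end Irreducibility

theorem isEisensteinAt_cyclotomic_prime_pow_comp {R : Type*} [CommRing R] [IsDomain R] {p : ℕ}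
    (hp : p.Prime) (hpR : Prime (p : R)) (n : ℕ) :
    ((cyclotomic (p ^ (n + 1)) R).comp (X + C 1)).IsEisensteinAt (Ideal.span {(p : R)}) := by
  have := Fact.mk hp
  have hmap : (cyclotomic (p ^ (n + 1)) R).comp (X + C 1) =
      ((cyclotomic (p ^ (n + 1)) ℤ).comp (X + 1)).map (Int.castRingHom R) := by
    simp [Polynomial.map_comp]
  have hweak := (cyclotomic_prime_pow_comp_X_add_one_isEisensteinAt p n).isWeaklyEisensteinAt.map
    (Int.castRingHom R)
  rw [← hmap, Ideal.submodule_span_eq, Ideal.map_span, Set.image_singleton, map_natCast] at hweak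
  refine ((cyclotomic.monic _ R).comp_X_add_C 1).isEisensteinAt_of_mem_of_notMem
    ((Ideal.span_singleton_prime hpR.ne_zero).mpr hpR).ne_top hweak.mem ?_
  have hcoeff : ((cyclotomic (p ^ (n + 1)) R).comp (X + C 1)).coeff 0 = p := by
    simp [coeff_zero_eq_eval_zero, eval_comp, eval_one_cyclotomic_prime_pow]
  rw [hcoeff, Ideal.span_singleton_pow, Ideal.mem_span_singleton]
  intro hdvd
  exact (pow_dvd_pow_iff hpR.ne_zero hpR.not_isUnit).not.mpr (by norm_num : ¬ 2 ≤ 1)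
    (by simpa using hdvd)

theorem irreducible_cyclotomic_prime_pow_of_prime {R : Type*} [CommRing R] [IsDomain R] {p : ℕ}
    (hp : p.Prime) (hpR : Prime (p : R)) (n : ℕ) : Irreducible (cyclotomic (p ^ (n + 1)) R) := by
  have hmonic := (cyclotomic.monic (p ^ (n + 1)) R).comp_X_add_C 1
  have hirr : Irreducible ((cyclotomic (p ^ (n + 1)) R).comp (X + C 1)) := by
    refine (isEisensteinAt_cyclotomic_prime_pow_comp hp hpR n).irreducible
      ((Ideal.span_singleton_prime hpR.ne_zero).mpr hpR) hmonic.isPrimitive ?_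
    rw [natDegree_comp, natDegree_X_add_C, mul_one, natDegree_cyclotomic]
    exact Nat.totient_pos.mpr (pow_pos hp.pos _)
  refine (MulEquiv.irreducible_iff (algEquivAevalXAddC (1 : R))).mp ?_
  rwa [algEquivAevalXAddC_apply, ← comp_eq_aeval]

section Uniformizer

variable {F Γ₀ : Type*} [Field F] [LinearOrderedCommGroupWithZero Γ₀] (V : Valuation F Γ₀)

theorem prime_valuationSubring_of_uniformizer {ϖ : V.valuationSubring} (hϖ0 : ϖ ≠ 0)
    (hϖ : V ϖ < 1) (hunif : ∀ x, V x < 1 → V x ≤ V ϖ) : Prime ϖ := by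
  have dvd_iff (x : V.valuationSubring) : ϖ ∣ x ↔ V x < 1 := by
    refine ⟨?_, fun hx ↦ ?_⟩
    · rintro ⟨y, rfl⟩
      exact (map_mul V _ _).trans_lt (mul_lt_one_of_lt_of_le hϖ y.2)
    · refine ⟨⟨x / ϖ, ?_⟩, Subtype.ext (mul_div_cancel₀ _ (by simpa using hϖ0)).symm⟩
      rw [Valuation.mem_valuationSubring_iff, map_div₀]
      exact div_le_one_of_le₀ (hunif _ hx) zero_le
  refine ⟨hϖ0, fun hu ↦ ?_, fun x y ↦ ?_⟩
  · simpa using (dvd_iff 1).mp (isUnit_iff_dvd_one.mp hu)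
  · rw [dvd_iff, dvd_iff, dvd_iff]
    contrapose!
    rintro ⟨hx, hy⟩
    exact (one_le_mul hx hy).trans (map_mul V _ _).ge

theorem irreducible_cyclotomic_of_uniformizer [CharZero F] {p : ℕ} (hp : p.Prime) (hp1 : V p < 1)
    (hunif : ∀ x, V x < 1 → V x ≤ V p) (i : ℕ) : Irreducible (cyclotomic (p ^ i) F) := by
  rcases i with - | n
  · simpa using irreducible_X_sub_C (1 : F)
  have hprime : Prime (p : V.valuationSubring) := prime_valuationSubring_of_uniformizer V
    (Nat.cast_ne_zero.mpr hp.ne_zero) (by simpa using hp1) (by simpa using hunif)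
  have hirr := irreducible_cyclotomic_prime_pow_of_prime hp hprime n
  rwa [(cyclotomic.monic _ _).irreducible_iff_irreducible_map_fraction_map (K := F),
    map_cyclotomic] at hirr

end Uniformizer

theorem irreducible_map_subtype_of_roots_mem {E Ω : Type*} [Field E] [Field Ω] [Algebra E Ω]
    [IsAlgClosed Ω] {F : Subfield E} {S : Subfield Ω}
    (hF : (algebraMap E Ω).fieldRange ⊓ S ≤ F.map (algebraMap E Ω)) {f : F[X]}
    (hf : Irreducible f) (hroots : ∀ r, aeval r (f.map F.subtype) = 0 → r ∈ S) :
    Irreducible (f.map F.subtype) := by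
  have hnu : ¬ IsUnit (f.map F.subtype) := by
    rw [isUnit_iff_degree_eq_zero, degree_map, ← isUnit_iff_degree_eq_zero]
    exact hf.not_isUnit
  obtain ⟨g, hgm, hg, hgf⟩ := exists_monic_irreducible_factor _ hnu
  have hgS : g.map (algebraMap E Ω) ∈ lifts S.subtype := by
    refine (IsAlgClosed.splits _).mem_lift_of_roots_mem_range (hgm.map _) _ fun r hr ↦ ?_
    have hgr : aeval r g = 0 := by simpa [aeval_def, eval_map] using isRoot_of_mem_roots hr
    exact ⟨⟨r, hroots r (aeval_eq_zero_of_dvd_aeval_eq_zero hgf hgr)⟩, rfl⟩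
  have hgF : g ∈ lifts F.subtype := (lifts_iff_coeff_lifts g).mpr fun n ↦ by
    obtain ⟨s, hs⟩ := (lifts_iff_coeff_lifts _).mp hgS n
    rw [coeff_map] at hs
    obtain ⟨y, hy, hyg⟩ := hF ⟨⟨g.coeff n, rfl⟩, hs ▸ s.2⟩
    exact ⟨⟨y, hy⟩, (algebraMap E Ω).injective hyg⟩
  obtain ⟨g₀, rfl⟩ := (mem_lifts g).mp hgF
  have hg₀ : ¬ IsUnit g₀ := fun h ↦ hg.not_isUnit (h.map (mapRingHom F.subtype))
  have hassoc := (hf.dvd_iff.mp ((map_dvd_map' F.subtype).mp hgf)).resolve_left hg₀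
  exact (hassoc.map (mapRingHom F.subtype)).irreducible_iff.mpr hg

theorem irreducible_cyclotomic_of_inf_le {E Ω : Type*} [Field E] [Field Ω] [Algebra E Ω]
    [IsAlgClosed Ω] {F : Subfield E} {S : Subfield Ω} {n : ℕ} (hS : ∀ z : Ω, z ^ n = 1 → z ∈ S)
    (hF : (algebraMap E Ω).fieldRange ⊓ S ≤ F.map (algebraMap E Ω))
    (hn : Irreducible (cyclotomic n F)) : Irreducible (cyclotomic n E) := by
  rw [← map_cyclotomic n F.subtype]
  refine irreducible_map_subtype_of_roots_mem hF hn fun r hr ↦ hS r ?_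
  obtain ⟨q, hq⟩ := cyclotomic.dvd_X_pow_sub_one n E
  rw [map_cyclotomic] at hr
  simpa [hr, sub_eq_zero] using congrArg (aeval r) hq

section PrimeField

variable {L Γ₀ : Type*} [Field L] [LinearOrderedCommGroupWithZero Γ₀] (V : Valuation L Γ₀)

theorem valuation_intCast_le_one (z : ℤ) : V (z : L) ≤ 1 :=
  intCast_mem V.valuationSubring z

theorem valuation_natCast_le_one (n : ℕ) : V (n : L) ≤ 1 :=
  natCast_mem V.valuationSubring n

theorem valuation_intCast_eq_one {p : ℕ} (hp : p.Prime) (hp1 : V p < 1) {z : ℤ}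
    (hz : ¬ (p : ℤ) ∣ z) : V (z : L) = 1 := by
  obtain ⟨a, b, hab⟩ := ((Nat.prime_iff_prime_int.mp hp).coprime_iff_not_dvd).mpr hz
  have hab' : (a : L) * p + b * z = 1 := by exact_mod_cast congrArg (Int.cast : ℤ → L) hab
  by_contra hne
  have hz1 : V (z : L) < 1 := lt_of_le_of_ne (valuation_intCast_le_one V z) hne
  have hlt : V ((a : L) * p + b * z) < 1 := by
    refine V.map_add_lt ?_ ?_ <;> rw [map_mul, mul_comm]
    exacts [mul_lt_one_of_lt_of_le hp1 (valuation_intCast_le_one V a),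
      mul_lt_one_of_lt_of_le hz1 (valuation_intCast_le_one V b)]
  simp [hab'] at hlt

theorem valuation_ratCast_le_of_lt_one [CharZero L] {p : ℕ} (hp : p.Prime) (hp1 : V p < 1) {q : ℚ}
    (hq : V (q : L) < 1) : V (q : L) ≤ V p := by
  have hdiv : V (q : L) = V (q.num : L) / V ((q.den : ℤ) : L) := by
    rw [← map_div₀, Int.cast_natCast, ← Rat.cast_def]
  have hnum : (p : ℤ) ∣ q.num := by
    by_contra hnum
    have hden : V ((q.den : ℤ) : L) ≠ 0 := by simp
    rw [hdiv, valuation_intCast_eq_one V hp hp1 hnum, div_lt_one₀ (zero_lt_iff.mpr hden)] at hq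
    exact (valuation_intCast_le_one V _).not_gt hq
  obtain ⟨k, hk⟩ := hnum
  have hden : ¬ (p : ℤ) ∣ (q.den : ℤ) := fun h ↦
    Nat.not_coprime_of_dvd_of_dvd hp.one_lt (Int.natCast_dvd.mp ⟨k, hk⟩)
      (Int.natCast_dvd_natCast.mp h) q.reduced
  rw [hdiv, valuation_intCast_eq_one V hp hp1 hden, hk, div_one, Int.cast_mul, Int.cast_natCast,
    map_mul]
  exact mul_le_of_le_one_right' (valuation_intCast_le_one V k)

end PrimeField

theorem valued_le_of_mem_topologicalClosure_bot {L Γ₀ : Type*} [Field L] [CharZero L]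
    [LinearOrderedCommGroupWithZero Γ₀] [Valued L Γ₀] {p : ℕ} (hp : p.Prime)
    (hp1 : Valued.v (p : L) < (1 : Γ₀)) {x : L} (hx : x ∈ (⊥ : Subfield L).topologicalClosure)
    (hx1 : Valued.v x < (1 : Γ₀)) : Valued.v x ≤ (Valued.v (p : L) : Γ₀) := by
  rcases eq_or_ne (Valued.v x : Γ₀) 0 with h0 | h0
  · simp [h0]
  have hx' : x ∈ closure ((⊥ : Subfield L) : Set L) := hx
  obtain ⟨y, hy : Valued.v y = Valued.v x, hyb⟩ :=
    mem_closure_iff_nhds.mp hx' _ (Valued.locally_const h0)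
  rw [Subfield.bot_eq_of_charZero] at hyb
  obtain ⟨q, rfl⟩ := hyb
  rw [← hy] at hx1 ⊢
  exact valuation_ratCast_le_of_lt_one Valued.v hp hp1 hx1

section PrimePowers

variable {L Γ₀ : Type*} [Field L] [LinearOrderedCommGroupWithZero Γ₀] (V : Valuation L Γ₀)
  {p : ℕ} {x y b : L}

theorem valuation_one_add_pow_prime_sub_sub_sub_le (hp : p.Prime) (hy : V y ≤ 1) :
    V ((1 + y) ^ p - 1 - y ^ p - p * y) ≤ V p * V y ^ 2 := by
  have hexp : (1 + y) ^ p - 1 - y ^ p - p * y =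
      p * y * ∑ k ∈ (Finset.Ioo 0 p).erase 1, y ^ (k - 1) * ((p.choose k / p : ℕ) : L) := by
    have hmem : 1 ∈ Finset.Ioo 0 p := Finset.mem_Ioo.mpr ⟨one_pos, hp.one_lt⟩
    have hadd := add_pow_prime_eq hp y 1
    simp only [one_pow, mul_one] at hadd
    rw [← Finset.add_sum_erase _ _ hmem, Nat.choose_one_right, Nat.div_self hp.pos] at hadd
    linear_combination hadd
  rw [hexp, map_mul, map_mul, mul_assoc, sq]
  gcongr
  refine V.map_sum_le fun k hk ↦ ?_
  obtain ⟨hk1, hk0, -⟩ : k ≠ 1 ∧ 0 < k ∧ k < p := by simpa using hk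
  rw [map_mul, map_pow]
  exact (mul_le_of_le_one_right' (valuation_natCast_le_one V _)).trans
    ((pow_le_pow_right_of_le_one' hy (by omega)).trans (pow_one _).le)

theorem valuation_one_add_pow_prime_sub_sub_le (hp : p.Prime) (hy : V y ≤ 1) :
    V ((1 + y) ^ p - 1 - y ^ p) ≤ V p * V y := by
  have hpy : V (p * y) = V p * V y := map_mul V _ _
  rw [← sub_add_cancel ((1 + y) ^ p - 1 - y ^ p) (p * y)]
  refine V.map_add_le ((valuation_one_add_pow_prime_sub_sub_sub_le V hp hy).trans ?_) hpy.le
  gcongr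
  exact (pow_le_pow_right_of_le_one' hy one_le_two).trans (pow_one _).le

theorem valuation_lt_one_of_pow_lt_natCast (hp : p.Prime) (hy : V y ^ (p - 1) < V p) :
    V y < 1 :=
  (pow_lt_one_iff (Nat.sub_ne_zero_of_lt hp.one_lt)).mp
    (hy.trans_le (valuation_natCast_le_one V p))

theorem valuation_one_add_pow_prime_sub_one_sub_lt (hp : p.Prime) (hy0 : y ≠ 0)
    (hy : V y ^ (p - 1) < V p) : V ((1 + y) ^ p - 1 - p * y) < V (p * y) := by
  have hV0 : 0 < V y := V.pos_iff.mpr hy0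
  have hp0 : 0 < V p := zero_le.trans_lt hy
  have hy1 : V y < 1 := valuation_lt_one_of_pow_lt_natCast V hp hy
  rw [show (1 + y) ^ p - 1 - p * y = ((1 + y) ^ p - 1 - y ^ p - p * y) + y ^ p by ring, map_mul]
  refine V.map_add_lt
    ((valuation_one_add_pow_prime_sub_sub_sub_le V hp hy1.le).trans_lt ?_) ?_
  · gcongr
    exact pow_lt_self_of_lt_one₀ hV0 hy1 one_lt_two
  · rw [map_pow, ← pow_sub_one_mul hp.ne_zero]
    gcongr

theorem valuation_one_add_pow_prime_sub_one (hp : p.Prime) (hy : V y ^ (p - 1) < V p) :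
    V ((1 + y) ^ p - 1) = V p * V y := by
  rcases eq_or_ne y 0 with rfl | hy0
  · simp
  · rw [← map_mul]
    exact V.map_eq_of_sub_lt (valuation_one_add_pow_prime_sub_one_sub_lt V hp hy0 hy)

theorem valuation_sub_one_lt_one_of_pow_prime (hp : p.Prime) (hp1 : V p < 1)
    (hb : V (b ^ p - 1) < 1) : V (b - 1) < 1 := by
  have hVb : V b ≤ 1 := by
    have hpow : V (b ^ p) = 1 := by simpa using V.map_one_add_of_lt hb
    rw [map_pow] at hpow
    exact ((pow_eq_one_iff.mp hpow).resolve_right hp.ne_zero).le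
  have hle : V (b - 1) ≤ 1 := V.map_sub_le hVb V.map_one.le
  have hmid := valuation_one_add_pow_prime_sub_sub_le V hp hle
  rw [add_sub_cancel] at hmid
  have hlt : V ((b - 1) ^ p) < 1 := by
    rw [← sub_sub_cancel (b ^ p - 1) ((b - 1) ^ p)]
    exact V.map_sub_lt hb (hmid.trans_lt (mul_lt_one_of_lt_of_le hp1 hle))
  rwa [map_pow, pow_lt_one_iff hp.ne_zero] at hlt

-- The valuation of `d ^ p - 1` is that of `p * (d - 1)` when `d` is close to `1`, which `hb` rules
-- out, and that of `(d - 1) ^ p` otherwise.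
theorem pow_prime_ne_of_valuation_sub_one_ne_pow (hp : p.Prime) (hp0 : (p : L) ≠ 0)
    (hp1 : V p < 1) (hb1 : V (b - 1) < 1) (hb : V p ^ p ≤ V (b - 1) ^ (p - 1))
    (hbz : ∀ z, V (b - 1) ≠ V z ^ p) (d : L) : d ^ p ≠ b := by
  rintro rfl
  have hVp : 0 < V p := V.pos_iff.mpr hp0
  have hd1 : V (d - 1) < 1 := valuation_sub_one_lt_one_of_pow_prime V hp hp1 hb1
  have hmid := valuation_one_add_pow_prime_sub_sub_le V hp hd1.le
  rw [add_sub_cancel] at hmid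
  have hpp : V (d - 1) ^ p = V (d - 1) ^ (p - 1) * V (d - 1) :=
    (pow_sub_one_mul hp.ne_zero _).symm
  have hp1' : p - 1 ≠ 0 := Nat.sub_ne_zero_of_lt hp.one_lt
  refine hbz (d - 1) ?_
  rcases lt_or_ge (V (d - 1) ^ (p - 1)) (V p) with hlt | hge
  · have heq := valuation_one_add_pow_prime_sub_one V hp hlt
    rw [add_sub_cancel] at heq
    refine absurd hb (not_le.mpr ?_)
    rw [heq, mul_pow, ← pow_sub_one_mul hp.ne_zero (V p)]
    exact mul_lt_mul_of_pos_left hlt (pow_pos hVp _)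
  · have hd0 : 0 < V (d - 1) := by
      refine zero_lt_iff.mpr fun h0 ↦ ?_
      rw [h0, zero_pow hp1'] at hge
      exact hVp.not_ge hge
    rcases hge.eq_or_lt with heq | hgt
    · have hle : V (d ^ p - 1) ≤ V (d - 1) ^ p := by
        rw [heq, ← hpp, ← map_pow] at hmid
        rw [← map_pow, ← sub_add_cancel (d ^ p - 1) ((d - 1) ^ p)]
        exact V.map_add_le hmid le_rfl
      refine hle.antisymm ((pow_le_pow_iff_left₀ zero_le zero_le hp1').mp ?_)
      rwa [pow_right_comm, ← heq]
    · rw [← map_pow]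
      refine V.map_eq_of_sub_lt (hmid.trans_lt ?_)
      rw [map_pow, hpp]
      gcongr

theorem valuation_pow_prime_sub_pow_prime_sub_lt (hp : p.Prime) (hx : V (x - 1) ^ (p - 1) < V p)
    (hy : V (y - 1) ^ (p - 1) < V p) (hxy : x ≠ y) :
    V (x ^ p - y ^ p - p * (x - y)) < V (p * (x - y)) := by
  have hp0 : (p : L) ≠ 0 := V.ne_zero_iff.mp (zero_le.trans_lt hx).ne'
  have hVy : V y = 1 := by
    simpa using V.map_one_add_of_lt (valuation_lt_one_of_pow_lt_natCast V hp hy)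
  have hy0 : y ≠ 0 := by rintro rfl; simp at hVy
  obtain ⟨t, rfl⟩ : ∃ t, x = y * (1 + t) := ⟨x / y - 1, by field_simp; ring⟩
  have ht0 : t ≠ 0 := by rintro rfl; simp at hxy
  have hyt : y * (1 + t) - y = y * t := by ring
  have hVt : V (y * (1 + t) - y) = V t := by rw [hyt, map_mul, hVy, one_mul]
  have ht : V t ^ (p - 1) < V p := by
    rw [← hVt, ← sub_sub_sub_cancel_right _ y 1]
    rcases le_total (V (y * (1 + t) - 1)) (V (y - 1)) with hle | hle
    · exact (pow_le_pow_left' (V.map_sub_le hle le_rfl) _).trans_lt hy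
    · exact (pow_le_pow_left' (V.map_sub_le le_rfl hle) _).trans_lt hx
  have hypy : V (y ^ p - y) < 1 := by
    have hlt := valuation_lt_one_of_pow_lt_natCast V hp hy
    have hpow := valuation_one_add_pow_prime_sub_one V hp hy
    rw [add_sub_cancel] at hpow
    rw [← sub_sub_sub_cancel_right _ y 1]
    refine V.map_sub_lt (hpow.trans_lt ?_) hlt
    exact mul_lt_one_of_nonneg_of_lt_one_right (valuation_natCast_le_one V p) zero_le hlt
  rw [map_mul, hVt, ← map_mul, show (y * (1 + t)) ^ p - y ^ p - p * (y * (1 + t) - y) =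
    y ^ p * ((1 + t) ^ p - 1 - p * t) + p * t * (y ^ p - y) by
      rw [mul_pow]; ring]
  refine V.map_add_lt ?_ ?_
  · rw [map_mul, map_pow, hVy, one_pow, one_mul]
    exact valuation_one_add_pow_prime_sub_one_sub_lt V hp ht0 ht
  · rw [map_mul]
    exact mul_lt_of_lt_one_right (V.pos_iff.mpr (mul_ne_zero hp0 ht0)) hypy

theorem valuation_pow_prime_pow_sub_one (hp : p.Prime) (hx : V (x - 1) ^ (p - 1) < V p) (c : ℕ) :
    V (x ^ p ^ c - 1) = V p ^ c * V (x - 1) := by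
  induction c with
  | zero => simp
  | succ c ih =>
    have hc : V (x ^ p ^ c - 1) ^ (p - 1) < V p := by
      rw [ih]
      refine (pow_le_pow_left' ?_ _).trans_lt hx
      exact mul_le_of_le_one_left' (pow_le_one' (valuation_natCast_le_one V p) c)
    have hpow := valuation_one_add_pow_prime_sub_one V hp hc
    rw [add_sub_cancel, ih, ← pow_mul, ← pow_succ] at hpow
    rw [hpow, pow_succ', mul_assoc]

theorem valuation_pow_div_self_sub_one (hx : V x = 1) (n : ℕ) :
    V (x ^ n / x - 1) = V (x ^ n - x) := by
  have hx0 : x ≠ 0 := by rintro rfl; simp at hx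
  rw [show x ^ n / x - 1 = (x ^ n - x) / x by field_simp, map_div₀, hx, div_one]

open WithZero in
theorem pow_prime_pow_succ_ne_of_valuation_eq_exp (V : Valuation L ℤᵐ⁰) (hp : p.Prime) {n : ℤ}
    (hn : ¬ (p : ℤ) ∣ n) {k : ℕ} (hx : V x = exp (n * p ^ k)) (d : L) :
    d ^ p ^ (k + 1) ≠ x := by
  rintro rfl
  have hd0 : V d ≠ 0 := by
    intro h0
    rw [map_pow, h0, zero_pow (pow_ne_zero _ hp.ne_zero)] at hx
    exact exp_ne_zero hx.symm
  rw [map_pow, ← exp_log hd0, ← exp_nsmul, exp_inj, nsmul_eq_mul, pow_succ'] at hx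
  push_cast at hx
  have hpk : (p : ℤ) ^ k ≠ 0 := pow_ne_zero _ (mod_cast hp.ne_zero)
  exact hn ⟨log (V d), mul_right_cancel₀ hpk (by linear_combination -hx)⟩

end PrimePowers

section CompleteRoots

open WithZero Filter Topology

variable {L : Type*} [Field L] [Valued L ℤᵐ⁰] {p c N : ℕ} {b u : L}

theorem nonarchimedeanRing_of_valued : NonarchimedeanRing L :=
  (Valued.toUniformSpace_eq L ℤᵐ⁰).symm ▸ Valued.v.subgroups_basis.nonarchimedean

theorem le_mul_exp_neg_one_of_lt {x y : ℤᵐ⁰} (hxy : x < y) : x ≤ y * exp (-1) := by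
  have hy0 : y * exp (-1) ≠ 0 := mul_ne_zero (zero_le.trans_lt hxy).ne' exp_ne_zero
  rwa [← lt_mul_exp_iff_le hy0, mul_assoc, ← exp_add, neg_add_cancel, exp_zero, mul_one]

theorem exp_neg_one_lt_one : (exp (-1) : ℤᵐ⁰) < 1 := by
  rw [← exp_zero, exp_lt_exp]
  decide

theorem tendsto_zero_of_valued_le {ι : Type*} {l : Filter ι} {s t : ι → L}
    (hst : ∀ i, Valued.v (s i) ≤ Valued.v (t i)) (ht : Tendsto t l (𝓝 0)) :
    Tendsto s l (𝓝 0) := by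
  have hbasis := Valued.hasBasis_nhds_zero L ℤᵐ⁰
  refine hbasis.tendsto_right_iff.mpr fun γ hγ ↦ ?_
  exact (hbasis.tendsto_right_iff.mp ht γ hγ).mono fun i hi ↦
    (Valued.v.restrict_le_iff.mpr (hst i)).trans_lt hi

theorem tendsto_zero_of_valued_le_mul_exp_neg_one_pow {s : ℕ → L} {r : ℤᵐ⁰}
    (hs : ∀ n, Valued.v (s n) ≤ r * exp (-1) ^ n) : Tendsto s atTop (𝓝 0) := by
  refine (Valued.hasBasis_nhds_zero L ℤᵐ⁰).tendsto_right_iff.mpr fun γ _ ↦ ?_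
  obtain ⟨n, hn⟩ : ∃ n : ℕ, r * exp (-1) ^ n < MonoidWithZeroHom.ValueGroup₀.embedding γ.1 := by
    rcases eq_or_ne r 0 with rfl | hr
    · exact ⟨0, by simp [zero_lt_iff]⟩
    obtain ⟨n, hn⟩ := exists_pow_lt₀ exp_neg_one_lt_one
      (Units.map (MonoidWithZeroHom.ValueGroup₀.embedding (f := .ofClass (Valued.v (R := L)))) γ
        / Units.mk0 r hr)
    refine ⟨n, ?_⟩
    rw [Units.val_div_eq_div_val] at hn
    exact (lt_div_iff₀' (zero_lt_iff.mpr hr)).mp hn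
  filter_upwards [eventually_ge_atTop n] with k hk
  change Valued.v.restrict (s k) < γ
  rw [Valuation.restrict_lt_iff_lt_embedding]
  refine ((hs k).trans ?_).trans_lt hn
  gcongr 1
  exact pow_le_pow_right_of_le_one' exp_neg_one_lt_one.le hk

theorem valued_sub_le_of_tendsto {s : ℕ → L} {a x : L} {r : ℤᵐ⁰} (hs : Tendsto s atTop (𝓝 x))
    (hr : ∀ n, Valued.v (s n - a) ≤ r) : Valued.v (x - a) ≤ r := by
  rcases eq_or_ne (Valued.v (x - a)) 0 with h0 | h0
  · exact h0.trans_le zero_le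
  · obtain ⟨n, hn⟩ := ((hs.sub_const a).eventually (Valued.locally_const h0)).exists
    exact hn.symm.trans_le (hr n)

theorem exists_isFixedPt_of_valued_sub_le [CompleteSpace L] {G : L → L} {a : L} {r : ℤᵐ⁰}
    (ha : Valued.v (G a - a) ≤ r)
    (hG : ∀ x y, Valued.v (x - a) ≤ r → Valued.v (y - a) ≤ r →
      Valued.v (G x - G y) ≤ Valued.v (x - y) * exp (-1)) :
    ∃ x, Valued.v (x - a) ≤ r ∧ Function.IsFixedPt G x := by
  have hGle : ∀ x y, Valued.v (x - a) ≤ r → Valued.v (y - a) ≤ r →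
      Valued.v (G x - G y) ≤ Valued.v (x - y) := fun x y hx hy ↦
    (hG x y hx hy).trans (mul_le_of_le_one_right' exp_neg_one_lt_one.le)
  have hball : ∀ n, Valued.v (G^[n] a - a) ≤ r := by
    intro n
    induction n with
    | zero => simp
    | succ n ih =>
      rw [Function.iterate_succ_apply', ← sub_add_sub_cancel _ (G a) a]
      exact Valued.v.map_add_le ((hGle _ _ ih (by simp)).trans ih) ha
  have hstep : ∀ n, Valued.v (G^[n + 1] a - G^[n] a) ≤ r * exp (-1) ^ n := by
    intro n
    induction n with
    | zero => simpa using ha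
    | succ n ih =>
      rw [Function.iterate_succ_apply' G (n + 1), pow_succ, ← mul_assoc]
      nth_rw 2 [Function.iterate_succ_apply']
      exact (hG _ _ (hball _) (hball _)).trans (by gcongr)
  have := nonarchimedeanRing_of_valued (L := L)
  obtain ⟨x, hx⟩ := cauchySeq_tendsto_of_complete
    (NonarchimedeanAddGroup.cauchySeq_of_tendsto_sub_nhds_zero (f := fun n ↦ G^[n] a)
      (tendsto_zero_of_valued_le_mul_exp_neg_one_pow hstep))
  have hxa : Valued.v (x - a) ≤ r := valued_sub_le_of_tendsto hx hball
  have hGx : Tendsto (fun n ↦ G (G^[n] a)) atTop (𝓝 (G x)) :=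
    tendsto_sub_nhds_zero_iff.mp <|
      tendsto_zero_of_valued_le (fun n ↦ hGle _ _ (hball n) hxa) (tendsto_sub_nhds_zero_iff.mpr hx)
  refine ⟨x, hxa, tendsto_nhds_unique hGx ?_⟩
  simpa only [← Function.iterate_succ_apply' G] using (tendsto_add_atTop_iff_nat 1).mpr hx

-- The root is the fixed point of Newton's iteration for `x ^ p - b` with the derivative frozen at
-- its value at `1`.
theorem exists_pow_prime_eq_of_valued_sub_one_lt [CompleteSpace L] (hp : p.Prime)
    (hb : Valued.v (b - 1) ^ (p - 1) < Valued.v (p : L) ^ p) :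
    ∃ x : L, x ^ p = b ∧ Valued.v (x - 1) ^ (p - 1) < Valued.v (p : L) := by
  set V : Valuation L ℤᵐ⁰ := Valued.v
  have hVp : 0 < V p := zero_lt_iff.mpr fun h0 ↦ by simp [h0, hp.ne_zero] at hb
  have hp0 : (p : L) ≠ 0 := V.ne_zero_iff.mp hVp.ne'
  have hr : (V (b - 1) / V p) ^ (p - 1) < V p := by
    rwa [div_pow, div_lt_iff₀ (pow_pos hVp _), mul_comm, pow_sub_one_mul hp.ne_zero]
  have hball : ∀ x, V (x - 1) ≤ V (b - 1) / V p → V (x - 1) ^ (p - 1) < V p :=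
    fun x hx ↦ (pow_le_pow_left' hx _).trans_lt hr
  obtain ⟨x, hx, hfix⟩ : ∃ x, V (x - 1) ≤ V (b - 1) / V p ∧
      Function.IsFixedPt (fun x ↦ x - (x ^ p - b) / p) x := by
    refine exists_isFixedPt_of_valued_sub_le ?_ fun x y hx hy ↦ ?_
    · rw [one_pow, sub_sub_cancel_left, ← neg_div, neg_sub, map_div₀]
    · rcases eq_or_ne x y with rfl | hxy
      · simp
      refine le_mul_exp_neg_one_of_lt ?_
      have hlt := valuation_pow_prime_sub_pow_prime_sub_lt V hp (hball x hx) (hball y hy) hxy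
      rw [show x - (x ^ p - b) / p - (y - (y ^ p - b) / p) =
        -((x ^ p - y ^ p - p * (x - y)) / p) by field_simp; ring]
      rwa [Valuation.map_neg, map_div₀, div_lt_iff₀' hVp, ← map_mul]
  refine ⟨x, ?_, hball x hx⟩
  simpa [Function.IsFixedPt, hp0, sub_eq_zero] using hfix

theorem exists_pow_prime_pow_eq_of_valued_sub_one_lt [CompleteSpace L] (hp : p.Prime)
    (hb : Valued.v (b - 1) ^ (p - 1) < Valued.v (p : L) ^ (c * (p - 1) + 1)) :
    ∃ x : L, x ^ p ^ c = b ∧ Valued.v (x - 1) ^ (p - 1) < Valued.v (p : L) := by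
  induction c generalizing b with
  | zero => exact ⟨b, by simp, by simpa using hb⟩
  | succ c ih =>
    have hVp : 0 < Valued.v (p : L) := by
      refine zero_lt_iff.mpr fun h0 ↦ ?_
      simp [h0] at hb
    have hexp : (c + 1) * (p - 1) + 1 = c * (p - 1) + p := by
      rw [add_one_mul, add_assoc, Nat.sub_add_cancel hp.one_le]
    have hb' : Valued.v (b - 1) ^ (p - 1) < Valued.v (p : L) ^ p :=
      hb.trans_le (pow_le_pow_right_of_le_one' (valuation_natCast_le_one Valued.v p) (by omega))
    obtain ⟨y, rfl, hy⟩ := exists_pow_prime_eq_of_valued_sub_one_lt hp hb'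
    have hVy := valuation_one_add_pow_prime_sub_one Valued.v hp hy
    rw [add_sub_cancel] at hVy
    rw [hVy, mul_pow, add_one_mul, add_right_comm, add_comm _ (p - 1), pow_add,
      mul_lt_mul_iff_right₀ (pow_pos hVp _)] at hb
    obtain ⟨x, rfl, hx⟩ := ih hb
    exact ⟨x, by rw [pow_succ, pow_mul], hx⟩

theorem exists_pow_prime_pow_eq_of_valued_pow_sub_lt [CompleteSpace L] (hp : p.Prime)
    (hu : Valued.v u = (1 : ℤᵐ⁰)) (hcN : c ≤ N)
    (hlt : Valued.v (u ^ p ^ N - u) ^ (p - 1) < Valued.v (p : L) ^ (c * (p - 1) + 1)) :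
    ∃ x : L, x ^ p ^ c = u := by
  have hu0 : u ≠ 0 := by rintro rfl; simp at hu
  rw [← valuation_pow_div_self_sub_one Valued.v hu] at hlt
  obtain ⟨x, hx, -⟩ := exists_pow_prime_pow_eq_of_valued_sub_one_lt hp hlt
  refine ⟨u ^ p ^ (N - c) / x, ?_⟩
  rw [div_pow, hx, ← pow_mul, ← pow_add, Nat.sub_add_cancel hcN]
  field_simp

theorem exists_pow_prime_pow_eq_div_self [CompleteSpace L] (hp : p.Prime)
    (hu : Valued.v u = (1 : ℤᵐ⁰)) (hu1 : Valued.v (u ^ p ^ N - u) < (1 : ℤᵐ⁰))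
    (hlt : 0 < c → Valued.v (u ^ p ^ N - u) ^ (p - 1) < Valued.v (p : L) ^ (c * (p - 1) + 1)) :
    ∃ x : L, x ^ p ^ c = u ^ p ^ N / u ∧ Valued.v (x - 1) < (1 : ℤᵐ⁰) ∧
      Valued.v (u ^ p ^ N - u) = Valued.v (p : L) ^ c * Valued.v (x - 1) := by
  rw [← valuation_pow_div_self_sub_one Valued.v hu] at hu1 hlt ⊢
  rcases Nat.eq_zero_or_pos c with rfl | hc
  · exact ⟨_, by simp, hu1, by simp⟩
  · obtain ⟨x, hx, hx1⟩ := exists_pow_prime_pow_eq_of_valued_sub_one_lt hp (hlt hc)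
    exact ⟨x, hx, valuation_lt_one_of_pow_lt_natCast Valued.v hp hx1,
      by rw [← hx, valuation_pow_prime_pow_sub_one Valued.v hp hx1]⟩

-- As `u ^ p ^ N` is a `p ^ (c + 1)`-th power, the claim is about `u ^ p ^ N / u`, which is close to
-- `1`; it has a `p ^ c`-th root `x`, and `x` is not a `p`-th power.
theorem pow_prime_pow_succ_ne_of_le_valued_pow_sub [CompleteSpace L] (hp : p.Prime) (hp2 : p ≠ 2)
    (hp0 : (p : L) ≠ 0) (hp1 : Valued.v (p : L) < (1 : ℤᵐ⁰))
    (hcyc : Irreducible (cyclotomic p L)) (hu : Valued.v u = (1 : ℤᵐ⁰)) (hcN : c < N)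
    (hu1 : Valued.v (u ^ p ^ N - u) < (1 : ℤᵐ⁰))
    (hlt : 0 < c → Valued.v (u ^ p ^ N - u) ^ (p - 1) < Valued.v (p : L) ^ (c * (p - 1) + 1))
    (hle : Valued.v (p : L) ^ ((c + 1) * (p - 1) + 1) ≤ Valued.v (u ^ p ^ N - u) ^ (p - 1))
    (hne : ∀ z : L, Valued.v (u ^ p ^ N - u) ≠ Valued.v (p : L) ^ c * Valued.v z ^ p) (d : L) :
    d ^ p ^ (c + 1) ≠ u := by
  intro hd
  have hVp : 0 < Valued.v (p : L) := zero_lt_iff.mpr ((Valuation.ne_zero_iff _).mpr hp0)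
  obtain ⟨x, hx, hx1, hxu⟩ := exists_pow_prime_pow_eq_div_self hp hu hu1 hlt
  have hroot : x = (u ^ p ^ (N - (c + 1)) / d) ^ p := by
    refine pow_prime_pow_injective hp hp2 hcyc c ?_
    change x ^ p ^ c = ((u ^ p ^ (N - (c + 1)) / d) ^ p) ^ p ^ c
    rw [hx, ← pow_mul, ← pow_succ', div_pow, hd, ← pow_mul, ← pow_add, Nat.sub_add_cancel hcN]
  refine pow_prime_ne_of_valuation_sub_one_ne_pow Valued.v hp hp0 hp1 hx1 ?_ ?_ _ hroot.symm
  · rw [hxu, mul_pow, ← pow_mul, add_one_mul, add_assoc, Nat.sub_add_cancel hp.one_le,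
      pow_add] at hle
    exact (mul_le_mul_iff_right₀ (pow_pos hVp _)).mp hle
  · intro z hz
    exact hne z (hxu.trans (by rw [hz]))

end CompleteRoots

section Level

variable {p e : ℕ}

theorem le_wieferichLevel_iff (hp : 1 < p) (he : 0 < e) {w j : ℤ} :
    j ≤ wieferichLevel p e w ↔ (e : ℤ) < ((p : ℤ) - 1) * (w - e * j) := by
  have hp' : (0 : ℚ) < (p : ℚ) - 1 := sub_pos.mpr (mod_cast hp)
  have he' : (0 : ℚ) < e := mod_cast he
  rw [wieferichLevel, ← Int.sub_one_lt_iff, Int.lt_ceil, div_sub_div _ _ he'.ne' hp'.ne',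
    lt_div_iff₀ (mul_pos he' hp'), ← Int.cast_lt (R := ℚ)]
  push_cast
  constructor <;> intro h <;> linarith

theorem exponent_bounds_of_eq_max {c m k : ℕ} {l : WithTop ℤ}
    (hc : (c : WithTop ℤ) = max 0 (min (m : WithTop ℤ) (min l (k : WithTop ℤ)))) :
    c ≤ m ∧ c ≤ k ∧ (0 < c → (c : WithTop ℤ) ≤ l) ∧
      (c < m → c < k → max 0 l = (c : WithTop ℤ)) := by
  induction l using WithTop.recTopCoe with
  | top =>
    have hc' : c = min m k := by
      rw [min_eq_right le_top, max_eq_right (le_min (by positivity) (by positivity)),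
        ← Nat.mono_cast.map_min] at hc
      exact_mod_cast hc
    exact ⟨by omega, by omega, fun _ ↦ le_top, by omega⟩
  | coe j =>
    have hc' : (c : ℤ) = max 0 (min (m : ℤ) (min j k)) := by exact_mod_cast hc
    exact ⟨by omega, by omega, fun _ ↦ by exact_mod_cast (show (c : ℤ) ≤ j by omega),
      fun _ _ ↦ by exact_mod_cast (show max 0 j = (c : ℤ) by omega)⟩

theorem exists_eq_coe_of_max_wieferichLevelTop_eq {c m : ℕ} {w₀ : WithTop ℤ} (hcm : c < m)
    (hc : max 0 (wieferichLevelTop p e w₀) = (c : WithTop ℤ))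
    (hw_nonpos : ∀ w : ℤ, w₀ = w → wieferichLevel p e w ≤ 0 → ¬ (p : ℤ) ∣ w)
    (hw_lt : ∀ w : ℤ, w₀ = w → wieferichLevel p e w < m →
      ¬ (p : ℤ) ∣ (e : ℤ) * wieferichLevel p e w - w) :
    ∃ w : ℤ, w₀ = w ∧ max 0 (wieferichLevel p e w) = c ∧ ¬ (p : ℤ) ∣ w - e * c := by
  induction w₀ using WithTop.recTopCoe with
  | top =>
    rw [wieferichLevelTop, WithTop.map_top, max_eq_right le_top] at hc
    exact absurd hc (WithTop.top_ne_natCast c)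
  | coe w =>
    rw [wieferichLevelTop, WithTop.map_coe] at hc
    have hcw : max 0 (wieferichLevel p e w) = c := by exact_mod_cast hc
    refine ⟨w, rfl, hcw, ?_⟩
    rcases le_or_gt (wieferichLevel p e w) 0 with hle | hlt
    · have hc0 : (c : ℤ) = 0 := by omega
      simpa only [hc0, mul_zero, sub_zero] using hw_nonpos w rfl hle
    · have hceq : wieferichLevel p e w = c := by omega
      rw [dvd_sub_comm, ← hceq]
      exact hw_lt w rfl (by omega)

end Level

section AdicCompletion

open WithZero

variable {K : Type*} [Field K] [NumberField K] {v : HeightOneSpectrum (𝓞 K)}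

theorem valued_algebraMap_adicCompletion (x : K) :
    Valued.v (algebraMap K (v.adicCompletion K) x) = v.valuation K x := by
  rw [HeightOneSpectrum.algebraMap_adicCompletion]
  exact HeightOneSpectrum.valuedAdicCompletion_eq_valuation' v x

theorem charZero_adicCompletion : CharZero (v.adicCompletion K) :=
  charZero_of_injective_algebraMap (algebraMap K (v.adicCompletion K)).injective

theorem primeOrd_eq_coe_iff {x : K} {w : ℤ} :
    primeOrd v x = w ↔ v.valuation K x = exp (-w) := by
  unfold primeOrd
  split_ifs with h
  · simp [h, exp_ne_zero.symm]
  · have h0 : v.valuation K x ≠ 0 := (Valuation.ne_zero_iff _).mpr h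
    rw [WithTop.coe_inj, ← exp_log h0, exp_inj, log_exp]
    omega

theorem valuation_eq_one_of_primeOrd_eq_zero {x : K} (hx : primeOrd v x = 0) :
    v.valuation K x = 1 := by
  simpa using primeOrd_eq_coe_iff.mp (hx.trans WithTop.coe_zero.symm)

variable {p : ℕ}

theorem valued_natCast_lt_one (hv : (p : 𝓞 K) ∈ v.asIdeal) :
    Valued.v (p : v.adicCompletion K) < (1 : ℤᵐ⁰) := by
  rw [← map_natCast (algebraMap K (v.adicCompletion K)), valued_algebraMap_adicCompletion]
  simpa using (v.valuation_lt_one_iff_mem (K := K) (p : 𝓞 K)).mpr hv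

theorem valued_natCast_eq_exp_neg_ramificationIdx (hp : p.Prime) (hv : (p : 𝓞 K) ∈ v.asIdeal) :
    Valued.v (p : v.adicCompletion K) = exp (-(v.asIdeal.ramificationIdx ℤ : ℤ)) := by
  have hp0 : (p : 𝓞 K) ≠ 0 := Nat.cast_ne_zero.mpr hp.ne_zero
  have hmap : (Ideal.span {(p : ℤ)}).map (algebraMap ℤ (𝓞 K)) = Ideal.span {(p : 𝓞 K)} := by
    rw [Ideal.map_span, Set.image_singleton, map_natCast]
  have hover : v.asIdeal.LiesOver (Ideal.span {(p : ℤ)}) :=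
    (Ideal.liesOver_span_iff v.isPrime.ne_top (Nat.prime_iff_prime_int.mp hp)).mpr
      (by simpa using hv)
  have hne : (Ideal.span {(p : ℤ)}).map (algebraMap ℤ (𝓞 K)) ≠ ⊥ := by
    rw [hmap]
    simpa using hp0
  rw [← map_natCast (algebraMap K (v.adicCompletion K)), valued_algebraMap_adicCompletion,
    Ideal.IsDedekindDomain.ramificationIdx_eq_multiplicity (Ideal.span {(p : ℤ)}) _ hne, hmap,
    ← v.intValuation_eq_exp_neg_multiplicity hp0, ← v.valuation_of_algebraMap (K := K)]
  simp

theorem irreducible_cyclotomic_adicCompletion (hp : p.Prime) (hv : (p : 𝓞 K) ∈ v.asIdeal)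
    (hcyc : (algebraMap (v.adicCompletion K)
          (AlgebraicClosure (v.adicCompletion K))).fieldRange ⊓ padicCyclotomicSubfield p v
        = padicSubfieldInClosure v) (i : ℕ) :
    Irreducible (cyclotomic (p ^ i) (v.adicCompletion K)) := by
  have := charZero_adicCompletion (v := v)
  have hp1 := valued_natCast_lt_one hv
  refine irreducible_cyclotomic_of_inf_le (S := padicCyclotomicSubfield p v)
    (fun z hz ↦ le_sup_right (a := padicSubfieldInClosure v) (Subfield.subset_closure ⟨i, hz⟩))
    hcyc.le ?_
  exact irreducible_cyclotomic_of_uniformizer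
    ((Valued.v : Valuation (v.adicCompletion K) ℤᵐ⁰).comap (padicSubfield v).subtype) hp
    (by simpa using hp1)
    (fun x hx ↦ by simpa using valued_le_of_mem_topologicalClosure_bot hp hp1 x.2 hx) i

variable {a₀ b : K} {c e k N : ℕ}

theorem pos_of_valued_natCast_eq_exp_neg (hv : (p : 𝓞 K) ∈ v.asIdeal)
    (he : Valued.v (p : v.adicCompletion K) = exp (-(e : ℤ))) : 0 < e := by
  have hlt := valued_natCast_lt_one hv
  rw [he, ← exp_zero, exp_lt_exp] at hlt
  omega

theorem natCast_le_wieferichLevelTop_primeOrd_iff (hp : p.Prime) (hv : (p : 𝓞 K) ∈ v.asIdeal)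
    (he : Valued.v (p : v.adicCompletion K) = exp (-(e : ℤ))) :
    (c : WithTop ℤ) ≤ wieferichLevelTop p e (primeOrd v b) ↔
      v.valuation K b ^ (p - 1) < Valued.v (p : v.adicCompletion K) ^ (c * (p - 1) + 1) := by
  rw [he]
  induction hw : primeOrd v b using WithTop.recTopCoe with
  | top =>
    have hb : b = 0 := by
      by_contra hb
      simp [primeOrd, hb] at hw
    simp [wieferichLevelTop, hb, Nat.sub_ne_zero_of_lt hp.one_lt, zero_lt_iff]
  | coe w =>
    have hc : (c : WithTop ℤ) = ((c : ℤ) : WithTop ℤ) := rfl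
    rw [wieferichLevelTop, WithTop.map_coe, hc, WithTop.coe_le_coe,
      le_wieferichLevel_iff hp.one_lt (pos_of_valued_natCast_eq_exp_neg hv he),
      primeOrd_eq_coe_iff.mp hw, ← exp_nsmul, ← exp_nsmul, exp_lt_exp]
    push_cast [nsmul_eq_mul, Nat.cast_sub hp.one_le]
    constructor <;> intro h <;> linarith

theorem wieferichLevel_primeOrd_lt_natCast_iff (hp : p.Prime) (hv : (p : 𝓞 K) ∈ v.asIdeal)
    (he : Valued.v (p : v.adicCompletion K) = exp (-(e : ℤ))) {w : ℤ} (hw : primeOrd v b = w) :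
    wieferichLevel p e w < c ↔
      Valued.v (p : v.adicCompletion K) ^ (c * (p - 1) + 1) ≤ v.valuation K b ^ (p - 1) := by
  rw [← not_lt, ← natCast_le_wieferichLevelTop_primeOrd_iff hp hv he, hw, wieferichLevelTop,
    WithTop.map_coe, ← not_le, not_iff_not, ← WithTop.coe_le_coe]
  rfl

theorem valued_algebraMap_pow_sub_self (n : ℕ) :
    Valued.v (algebraMap K (v.adicCompletion K) b ^ n - algebraMap K _ b) =
      v.valuation K (b ^ n - b) := by
  rw [← map_pow, ← map_sub, valued_algebraMap_adicCompletion]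

theorem exists_pow_prime_pow_eq_algebraMap (hp : p.Prime) (hv : (p : 𝓞 K) ∈ v.asIdeal)
    (he : Valued.v (p : v.adicCompletion K) = exp (-(e : ℤ))) (ha₀ : primeOrd v a₀ = 0)
    (hcN : c ≤ N)
    (hc : 0 < c → (c : WithTop ℤ) ≤ wieferichLevelTop p e (primeOrd v (a₀ ^ p ^ N - a₀))) :
    ∃ y, y ^ p ^ c = algebraMap K (v.adicCompletion K) a₀ := by
  rcases Nat.eq_zero_or_pos c with rfl | hc0
  · exact ⟨_, by rw [pow_zero, pow_one]⟩
  · refine exists_pow_prime_pow_eq_of_valued_pow_sub_lt hp (N := N) ?_ hcN ?_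
    · rw [valued_algebraMap_adicCompletion, valuation_eq_one_of_primeOrd_eq_zero ha₀]
    · rw [valued_algebraMap_pow_sub_self]
      exact (natCast_le_wieferichLevelTop_primeOrd_iff hp hv he).mp (hc hc0)

theorem valued_ne_valued_natCast_pow_mul_pow {w : ℤ}
    (he : Valued.v (p : v.adicCompletion K) = exp (-(e : ℤ))) (hpw : ¬ (p : ℤ) ∣ w - e * c)
    (z : v.adicCompletion K) :
    exp (-w) ≠ Valued.v (p : v.adicCompletion K) ^ c * Valued.v z ^ p := by
  intro hz
  have hz0 : Valued.v z ^ p ≠ 0 := right_ne_zero_of_mul (hz ▸ exp_ne_zero)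
  rw [← exp_log hz0, he, ← exp_nsmul, ← exp_add, exp_inj, log_pow, nsmul_eq_mul,
    nsmul_eq_mul] at hz
  exact hpw ⟨-log (Valued.v z), by linear_combination -hz⟩

theorem valuation_lt_one_of_max_eq (hp : p.Prime) (hv : (p : 𝓞 K) ∈ v.asIdeal)
    (he : Valued.v (p : v.adicCompletion K) = exp (-(e : ℤ))) (hb : v.valuation K b ≤ 1)
    {w : ℤ} (hw : primeOrd v b = w) (hl : max 0 (wieferichLevel p e w) = c)
    (hpw : ¬ (p : ℤ) ∣ w - e * c) : v.valuation K b < 1 := by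
  rw [primeOrd_eq_coe_iff.mp hw, ← exp_zero] at hb ⊢
  rw [exp_le_exp] at hb
  rw [exp_lt_exp]
  refine hb.lt_of_ne fun hw0 ↦ ?_
  have hw0' : w = 0 := by omega
  subst hw0'
  have hc0 : c = 0 := by
    by_contra hc
    have hle : (1 : ℤ) ≤ wieferichLevel p e 0 := by omega
    rw [le_wieferichLevel_iff hp.one_lt (pos_of_valued_natCast_eq_exp_neg hv he)] at hle
    nlinarith [hp.two_le]
  simp [hc0] at hpw

theorem pow_prime_pow_succ_ne_algebraMap_of_max_eq (hp : p.Prime) (hp2 : p ≠ 2)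
    (hv : (p : 𝓞 K) ∈ v.asIdeal)
    (he : Valued.v (p : v.adicCompletion K) = exp (-(e : ℤ)))
    (hcyc : Irreducible (cyclotomic p (v.adicCompletion K))) (ha₀ : primeOrd v a₀ = 0)
    (hcN : c < N) {w : ℤ} (hw : primeOrd v (a₀ ^ p ^ N - a₀) = w)
    (hl : max 0 (wieferichLevel p e w) = c) (hpw : ¬ (p : ℤ) ∣ w - e * c) (d : v.adicCompletion K) :
    d ^ p ^ (c + 1) ≠ algebraMap K (v.adicCompletion K) a₀ := by
  have := charZero_adicCompletion (v := v)
  have hV := valued_algebraMap_pow_sub_self (v := v) (b := a₀) (p ^ N)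
  have ha₀1 := valuation_eq_one_of_primeOrd_eq_zero ha₀
  have hV1 : v.valuation K (a₀ ^ p ^ N - a₀) ≤ 1 :=
    Valuation.map_sub_le _ (by rw [map_pow, ha₀1, one_pow]) ha₀1.le
  refine pow_prime_pow_succ_ne_of_le_valued_pow_sub hp hp2 (mod_cast hp.ne_zero)
    (valued_natCast_lt_one hv) hcyc ?_ hcN ?_ ?_ ?_ ?_ d
  · rw [valued_algebraMap_adicCompletion, ha₀1]
  · rw [hV]
    exact valuation_lt_one_of_max_eq hp hv he hV1 hw hl hpw
  · intro hc0
    rw [hV, ← not_le, ← wieferichLevel_primeOrd_lt_natCast_iff hp hv he hw]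
    omega
  · rw [hV, ← wieferichLevel_primeOrd_lt_natCast_iff hp hv he hw]
    omega
  · rw [hV, primeOrd_eq_coe_iff.mp hw]
    exact valued_ne_valued_natCast_pow_mul_pow he hpw

theorem valued_algebraMap_mul_pow_prime_pow {h : ℤ} (ha₀ : primeOrd v a₀ = 0)
    (hb : primeOrd v b = h) :
    Valued.v (algebraMap K (v.adicCompletion K) (a₀ * b ^ p ^ k)) = exp (-h * p ^ k) := by
  rw [valued_algebraMap_adicCompletion, map_mul, map_pow,
    valuation_eq_one_of_primeOrd_eq_zero ha₀, primeOrd_eq_coe_iff.mp hb, one_mul, ← exp_nsmul,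
    nsmul_eq_mul, mul_comm, Nat.cast_pow]

theorem pow_prime_pow_succ_ne_algebraMap_mul_pow (hp : p.Prime) (hp2 : p ≠ 2)
    (hv : (p : 𝓞 K) ∈ v.asIdeal)
    (he : Valued.v (p : v.adicCompletion K) = exp (-(e : ℤ)))
    (hcyc : Irreducible (cyclotomic p (v.adicCompletion K))) (ha₀ : primeOrd v a₀ = 0)
    {h : ℤ} (hb : primeOrd v b = h) (hh : ¬ (p : ℤ) ∣ h) {m : ℕ} (hcm : c < m) (hmN : m ≤ N)
    (hck : c ≤ k) {w₀ : WithTop ℤ} (hw₀ : w₀ = primeOrd v (a₀ ^ p ^ N - a₀))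
    (hw_nonpos : ∀ w : ℤ, w₀ = w → wieferichLevel p e w ≤ 0 → ¬ (p : ℤ) ∣ w)
    (hw_lt : ∀ w : ℤ, w₀ = w → wieferichLevel p e w < m →
      ¬ (p : ℤ) ∣ (e : ℤ) * wieferichLevel p e w - w)
    (hmax : c < k → max 0 (wieferichLevelTop p e w₀) = (c : WithTop ℤ)) (d : v.adicCompletion K) :
    d ^ p ^ (c + 1) ≠ algebraMap K (v.adicCompletion K) (a₀ * b ^ p ^ k) := by
  rcases hck.eq_or_lt with rfl | hck
  · exact pow_prime_pow_succ_ne_of_valuation_eq_exp Valued.v hp (by rwa [dvd_neg])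
      (valued_algebraMap_mul_pow_prime_pow ha₀ hb) d
  · obtain ⟨w, hw, hl, hpw⟩ :=
      exists_eq_coe_of_max_wieferichLevelTop_eq hcm (hmax hck) hw_nonpos hw_lt
    have hb0 : algebraMap K (v.adicCompletion K) b ≠ 0 := by
      rw [_root_.map_ne_zero]
      rintro rfl
      simp [primeOrd] at hb
    intro hd
    refine pow_prime_pow_succ_ne_algebraMap_of_max_eq hp hp2 hv he hcyc ha₀ (hcm.trans_le hmN)
      (hw₀.symm.trans hw) hl hpw (d / algebraMap K _ b ^ p ^ (k - (c + 1))) ?_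
    rw [div_pow, hd, ← pow_mul, ← pow_add, Nat.sub_add_cancel hck, map_mul, map_pow,
      mul_div_cancel_right₀ _ (pow_ne_zero _ hb0)]

theorem exists_pow_prime_pow_eq_algebraMap_mul_pow (hp : p.Prime) (hv : (p : 𝓞 K) ∈ v.asIdeal)
    (he : Valued.v (p : v.adicCompletion K) = exp (-(e : ℤ))) (ha₀ : primeOrd v a₀ = 0)
    (hcN : c ≤ N) (hck : c ≤ k)
    (hc : 0 < c → (c : WithTop ℤ) ≤ wieferichLevelTop p e (primeOrd v (a₀ ^ p ^ N - a₀))) :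
    ∃ y, y ^ p ^ c = algebraMap K (v.adicCompletion K) (a₀ * b ^ p ^ k) := by
  obtain ⟨y, hy⟩ := exists_pow_prime_pow_eq_algebraMap hp hv he ha₀ hcN hc
  refine ⟨y * algebraMap K _ b ^ p ^ (k - c), ?_⟩
  rw [mul_pow, hy, ← pow_mul, ← pow_add, Nat.sub_add_cancel hck, map_mul, map_pow]

theorem primeOrd_pow_of_primeOrd_eq_one (hb : primeOrd v b = 1) (n : ℕ) :
    primeOrd v (b ^ n) = ((n : ℤ) : WithTop ℤ) := by
  rw [primeOrd_eq_coe_iff, map_pow, primeOrd_eq_coe_iff.mp (hb.trans WithTop.coe_one.symm),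
    ← exp_nsmul, nsmul_eq_mul, mul_neg_one]

end AdicCompletion

theorem proposition8p1_general {K : Type*} [Field K] [NumberField K]
    {p : ℕ} (hp : p.Prime) (hp_odd : p ≠ 2)
    {v : HeightOneSpectrum (𝓞 K)} (hv : (p : 𝓞 K) ∈ v.asIdeal)
    {e : ℕ} (he : e = v.asIdeal.ramificationIdx ℤ)
    (hcyc : (algebraMap (v.adicCompletion K)
          (AlgebraicClosure (v.adicCompletion K))).fieldRange ⊓ padicCyclotomicSubfield p v
        = padicSubfieldInClosure v)
    {m N : ℕ} (hmN : m ≤ N) {a a₀ b : K} (ha₀ : primeOrd v a₀ = 0)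
    {h : ℤ} (hb : primeOrd v b = h) (hh : ¬ (p : ℤ) ∣ h) {k : ℕ} (ha : a = a₀ * b ^ p ^ k)
    {w₀ : WithTop ℤ} (hw₀ : w₀ = primeOrd v (a₀ ^ p ^ N - a₀))
    (hw_nonpos : ∀ w : ℤ, w₀ = w → wieferichLevel p e w ≤ 0 → ¬ (p : ℤ) ∣ w)
    (hw_lt : ∀ w : ℤ, w₀ = w → wieferichLevel p e w < m →
      ¬ (p : ℤ) ∣ (e : ℤ) * wieferichLevel p e w - w)
    {c : ℕ}
    (hc : (c : WithTop ℤ) =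
      max 0 (min (m : WithTop ℤ) (min (wieferichLevelTop p e w₀) (k : WithTop ℤ)))) :
    (∃ α : v.adicCompletion K, α ^ p ^ c = algebraMap K (v.adicCompletion K) a) ∧
    ∀ α : v.adicCompletion K, α ^ p ^ c = algebraMap K (v.adicCompletion K) a →
      ∃ Φ : ℕ → (v.adicCompletion K)[X],
        (∀ i ∈ Finset.Icc 1 c, ∀ ζ : AlgebraicClosure (v.adicCompletion K),
          IsPrimitiveRoot ζ (p ^ i) →
          (Φ i).map (algebraMap (v.adicCompletion K) (AlgebraicClosure (v.adicCompletion K))) =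
            twistedCyclotomic p i ζ
              (algebraMap (v.adicCompletion K) (AlgebraicClosure (v.adicCompletion K)) α)) ∧
        (X ^ p ^ m - C (algebraMap K (v.adicCompletion K) a) : (v.adicCompletion K)[X]) =
          (X ^ p ^ (m - c) - C α) *
            ∏ i ∈ Finset.Icc 1 c, (Φ i).comp (X ^ p ^ (m - c)) ∧
        Irreducible (X ^ p ^ (m - c) - C α : (v.adicCompletion K)[X]) ∧
        ∀ i ∈ Finset.Icc 1 c, Irreducible ((Φ i).comp (X ^ p ^ (m - c))) := by
  have := charZero_adicCompletion (v := v)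
  have heV := valued_natCast_eq_exp_neg_ramificationIdx hp hv
  rw [← he] at heV
  have hirr := irreducible_cyclotomic_adicCompletion hp hv hcyc
  obtain ⟨hcm, hck, hcl, hmax⟩ := exponent_bounds_of_eq_max hc
  refine ⟨ha ▸ exists_pow_prime_pow_eq_algebraMap_mul_pow hp hv heV ha₀ (hcm.trans hmN) hck
    (hw₀ ▸ hcl), fun α hα ↦ ?_⟩
  have hα0 : α ≠ 0 := by
    rintro rfl
    rw [zero_pow (pow_ne_zero _ hp.ne_zero)] at hα
    refine WithZero.exp_ne_zero ?_ (a := -h * p ^ k)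
    rw [← valued_algebraMap_mul_pow_prime_pow ha₀ hb, ← ha, ← hα, map_zero]
  have hα_ne : c < m → ∀ δ, δ ^ p ≠ α := by
    rintro hcm δ rfl
    refine pow_prime_pow_succ_ne_algebraMap_mul_pow hp hp_odd hv heV (by simpa using hirr 1) ha₀
      hb hh hcm hmN hck hw₀ hw_nonpos hw_lt (hmax hcm) δ ?_
    rw [← ha, ← hα, pow_succ', pow_mul]
  rw [← hα]
  exact exists_irreducible_twistedCyclotomic_factorization _ hp hp_odd hirr hcm hα0 hα_ne

theorem proposition8p1 {K : Type*} [Field K] [NumberField K]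
    (p : ℕ) (hp : p.Prime) (hp_odd : p ≠ 2)
    (v : HeightOneSpectrum (𝓞 K)) (hv : (p : 𝓞 K) ∈ v.asIdeal)
    (e f : ℕ) (he : e = v.asIdeal.ramificationIdx ℤ) (hf : f = v.asIdeal.inertiaDeg ℤ)
    (hep : ¬ p ∣ e)
    (hcyc : (algebraMap (v.adicCompletion K)
          (AlgebraicClosure (v.adicCompletion K))).fieldRange ⊓ padicCyclotomicSubfield p v
        = padicSubfieldInClosure v)
    (m : ℕ) (a : 𝓞 K) (hirr : Irreducible (X ^ p ^ m - C a : (𝓞 K)[X]))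
    (π : 𝓞 K) (hπ : primeOrd v (π : K) = 1)
    (a₀ : K) (ha₀ : primeOrd v a₀ = 0)
    (h k : ℕ) (hh : ¬ p ∣ h) (ha : (a : K) = a₀ * (π : K) ^ (h * p ^ k))
    (μ : ℕ) (hμ_pos : 1 ≤ μ) (hμ_le : μ ≤ f) (hμ : μ ≡ m [MOD f])
    (w₀ : WithTop ℤ) (hw₀ : w₀ = primeOrd v (a₀ ^ p ^ (f - μ + m) - a₀))
    (hw_nonpos : ∀ w : ℤ, w₀ = w → wieferichLevel p e w ≤ 0 → ¬ (p : ℤ) ∣ w)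
    (hw_lt : ∀ w : ℤ, w₀ = w → wieferichLevel p e w < m →
      ¬ (p : ℤ) ∣ (e : ℤ) * wieferichLevel p e w - w)
    (c : ℕ)
    (hc : (c : WithTop ℤ) =
      max 0 (min (m : WithTop ℤ) (min (wieferichLevelTop p e w₀) (k : WithTop ℤ)))) :
    (∃ α : v.adicCompletion K, α ^ p ^ c = algebraMap K (v.adicCompletion K) a) ∧
    ∀ α : v.adicCompletion K, α ^ p ^ c = algebraMap K (v.adicCompletion K) a →
      ∃ Φ : ℕ → (v.adicCompletion K)[X],
        (∀ i ∈ Finset.Icc 1 c, ∀ ζ : AlgebraicClosure (v.adicCompletion K),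
          IsPrimitiveRoot ζ (p ^ i) →
          (Φ i).map (algebraMap (v.adicCompletion K) (AlgebraicClosure (v.adicCompletion K))) =
            twistedCyclotomic p i ζ
              (algebraMap (v.adicCompletion K) (AlgebraicClosure (v.adicCompletion K)) α)) ∧
        (X ^ p ^ m - C (algebraMap K (v.adicCompletion K) a) : (v.adicCompletion K)[X]) =
          (X ^ p ^ (m - c) - C α) *
            ∏ i ∈ Finset.Icc 1 c, (Φ i).comp (X ^ p ^ (m - c)) ∧
        Irreducible (X ^ p ^ (m - c) - C α : (v.adicCompletion K)[X]) ∧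
        ∀ i ∈ Finset.Icc 1 c, Irreducible ((Φ i).comp (X ^ p ^ (m - c))) := by
  exact proposition8p1_general hp hp_odd hv he hcyc (Nat.le_add_left m _) ha₀
    (primeOrd_pow_of_primeOrd_eq_one hπ h) (mod_cast hh) (by rw [ha, pow_mul]) hw₀
    hw_nonpos hw_lt hc
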